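/- Let $R$ be an integral domain that is not a field, with field of fractions $K$. An ideal of $R$ is called stable if it is projective over its endomorphism ring; $R$ is finitely stable if every nonzero finitely generated ideal of $R$ is stable; $R$ is Archimedean if $\bigcap_{n\ge 0} r^nR=(0)$ for every nonunit $r\in R$. A local ring is a ring with a unique maximal ideal (not necessarily Noetherian). Suppose that $R$ is local with maximal ideal $M$. Put $R_0=R$ and, for $n\ge 1$, put $R_n=(M_{n-1}:M_{n-1})=\{x\in K: xM_{n-1}\subseteq M_{n-1}\}$ if $R_{n-1}$ is local with maximal ideal $M_{n-1}$, and $R_n=R_{n-1}$ if $R_{n-1}$ is not local. Let $T=\bigcup_{n\ge 0}R_n$. Assume that $R$ is Archimedean and finitely stable and that $M$ is stable. If $T$ is local, then $R$ has Krull dimension one. In particular, this applies if $T\ne R_n$ for all $n\ge 0$: in that case $T$ is local. -/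

import Mathlib

namespace OlberdingChain

/-- An ideal `I` is stable if it is projective as a module over its endomorphism ring. -/
def IsStableIdeal {R : Type*} [CommRing R] (I : Ideal R) : Prop :=
  Module.Projective (Module.End R I) I

/-- A domain is finitely stable if each nonzero finitely generated ideal is stable. -/
def IsFinitelyStable (R : Type*) [CommRing R] : Prop :=
  ∀ I : Ideal R, I ≠ ⊥ → I.FG → IsStableIdeal I

/-- A domain is Archimedean if `⋂ n, rⁿR = 0` for each nonunit `r`. -/
def IsArchimedeanDomain (R : Type*) [CommRing R] : Prop :=
  ∀ r : R, ¬ IsUnit r → ⨅ n : ℕ, Ideal.span {r ^ n} = ⊥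

section Chain

variable {R : Type*} [CommRing R] {K : Type*} [Field K] [Algebra R K]

/-- `E(J) = (J : J) = {x ∈ K | xJ ⊆ J}`, for an ideal `J` of an intermediate ring `A` of `R ⊆ K`. -/
def endRing {A : Subalgebra R K} (J : Ideal A) : Subalgebra R K where
  carrier := {x : K | ∀ y ∈ J, ∃ z ∈ J, x * (y : K) = (z : K)}
  mul_mem' := by
    intro a b ha hb y hy
    obtain ⟨z, hz, e⟩ := hb y hy
    obtain ⟨w, hw, f⟩ := ha z hz
    exact ⟨w, hw, by rw [mul_assoc, e, f]⟩
  add_mem' := by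
    intro a b ha hb y hy
    obtain ⟨z, hz, e⟩ := ha y hy
    obtain ⟨w, hw, f⟩ := hb y hy
    exact ⟨z + w, J.add_mem hz hw, by rw [add_mul, e, f]; rfl⟩
  algebraMap_mem' := by
    intro r y hy
    exact ⟨algebraMap R A r * y, J.mul_mem_left _ hy, rfl⟩

open Classical in
/-- One step: `A ↦ E(M_A)` if `A` is local with maximal ideal `M_A`, and `A ↦ A` otherwise. -/
noncomputable def step (A : Subalgebra R K) : Subalgebra R K :=
  if _h : IsLocalRing A then endRing (IsLocalRing.maximalIdeal A) else A

variable (R K)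

/-- The chain `R = R₀ ⊆ R₁ ⊆ R₂ ⊆ ⋯` of subrings of `K`; `R` is identified with its image
`⊥` in `K`. -/
noncomputable def chain : ℕ → Subalgebra R K
  | 0 => ⊥
  | n + 1 => step (chain n)

/-- `T = ⋃ n, Rₙ`. The supremum is the union, see `mem_chainUnion`. -/
noncomputable def chainUnion : Subalgebra R K := ⨆ n, chain R K n

variable {R K}

theorem le_step (A : Subalgebra R K) : A ≤ step A := by
  unfold step
  split_ifs with h
  · intro x hx y hy
    exact ⟨⟨x, hx⟩ * y, Ideal.mul_mem_left _ _ hy, rfl⟩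
  · exact le_rfl

theorem chain_mono : Monotone (chain R K) :=
  monotone_nat_of_le_succ fun n => le_step (chain R K n)

theorem mem_chainUnion {x : K} : x ∈ chainUnion R K ↔ ∃ n, x ∈ chain R K n := by
  have h := Subalgebra.coe_iSup_of_directed (chain_mono (R := R) (K := K)).directed_le
  rw [← SetLike.mem_coe, chainUnion, h]
  simp

end Chain

end OlberdingChain

/-!
The rings `R₀ ⊆ R₁ ⊆ ⋯` of the chain are studied inside `K`; `M_A` denotes the maximal ideal of a
local ring `A` of the chain, and `E(M_A)` is the next ring.

If `T` is local, then every `Rₙ` is local, because the chain stops at the first ring that is not.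
So let all `Rₙ` be local. As `M` is stable and `E(M) = R₁` is local, `M = m R₁` for some `m ∈ M`
(`IsStableSet.exists_forall_eq_mul`). The core of the argument is that this same `m` works at all
levels: for each `n` either `Mₙ = m Rₙ₊₁`, or `Mₙ = t Rₙ` is principal with `m` associated to
`t ^ 2` (`IsControlledBy`, `exists_forall_isControlledBy`).

For the inductive step let `A = Rₙ` with `M_A = m E(M_A)`. Finite stability forces every finitely
generated `A`-module between `A` and `E(M_A)` to be a ring (`mul_mem_of_isStableSet`). Applied to
`A + A x + A y` for nonunits `x, y` of `E(M_A)`, this gives `x y ∈ M_A`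
(`mul_mem_nonunitsIn_of_mem_step`). Hence the maximal ideal `N` of `E(M_A)` satisfies
`N N ⊆ m E(M_A)`, and the alternative for `N` follows by asking whether even `N N ⊆ m N`
(`IsControlledBy.step`).

Let `P` be a prime of `R` not containing `m`, and `p ∈ P`. By the alternative, `p = m ^ n z` with
`z ∈ Rₙ` for every `n` (`exists_eq_pow_mul_of_mem_prime`), whereas `m ^ n Rₙ ⊆ R`
(`exists_algebraMap_eq_pow_mul`). So `p ^ 2 = m ^ n (m ^ n z ^ 2) ∈ m ^ n R` for all `n`, and
`p = 0` as `R` is Archimedean. Thus each nonzero prime contains `m`, and then all of `M` because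
the squares of elements of `M` are multiples of `m`.
-/

namespace OlberdingChain

/-! ### Nonunits of subalgebras of a field -/

section LocalSubalgebra

variable {R : Type*} [CommRing R] {K : Type*} [Field K] [Algebra R K]

/-- The nonunits of the subalgebra `A` of the field `K`, as a subset of `K`. When `A` is local this
is the underlying set of its maximal ideal. -/
def nonunitsIn (A : Subalgebra R K) : Set K := {x | x ∈ A ∧ ∀ y ∈ A, x * y ≠ 1}

theorem ne_zero_and_inv_mem {A : Subalgebra R K} {x : K} (hx : x ∈ A) (hn : x ∉ nonunitsIn A) :
    x ≠ 0 ∧ x⁻¹ ∈ A := by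
  simp only [nonunitsIn, Set.mem_ofPred_eq, not_and, not_forall, not_not] at hn
  obtain ⟨y, hy, hxy⟩ := hn hx
  have h0 : x ≠ 0 := left_ne_zero_of_mul_eq_one hxy
  refine ⟨h0, ?_⟩
  rwa [← eq_inv_of_mul_eq_one_right hxy]

theorem one_notMem_nonunitsIn {A : Subalgebra R K} : (1 : K) ∉ nonunitsIn A :=
  fun h => h.2 1 A.one_mem (one_mul 1)

theorem zero_mem_nonunitsIn {A : Subalgebra R K} : (0 : K) ∈ nonunitsIn A :=
  ⟨A.zero_mem, fun y _ => by simp⟩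

theorem mul_mem_nonunitsIn {A : Subalgebra R K} {a x : K} (ha : a ∈ A) (hx : x ∈ nonunitsIn A) :
    a * x ∈ nonunitsIn A :=
  ⟨A.mul_mem ha hx.1, fun y hy h => hx.2 (a * y) (A.mul_mem ha hy) (by rw [← h]; ring)⟩

theorem coe_mem_nonunitsIn {A : Subalgebra R K} (x : A) :
    (x : K) ∈ nonunitsIn A ↔ x ∈ nonunits A := by
  rw [mem_nonunits_iff, isUnit_iff_exists_inv]
  simp only [nonunitsIn, Set.mem_ofPred_eq, SetLike.coe_mem, true_and, not_exists]
  refine ⟨fun h y hy => h y y.2 (by exact_mod_cast congrArg Subtype.val hy), fun h y hy hxy =>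
    h ⟨y, hy⟩ (Subtype.ext hxy)⟩

variable {A : Subalgebra R K}

theorem coe_mem_nonunitsIn_iff [IsLocalRing A] (x : A) :
    (x : K) ∈ nonunitsIn A ↔ x ∈ IsLocalRing.maximalIdeal A := by
  rw [coe_mem_nonunitsIn, IsLocalRing.mem_maximalIdeal]

theorem add_mem_nonunitsIn [IsLocalRing A] {x y : K} (hx : x ∈ nonunitsIn A)
    (hy : y ∈ nonunitsIn A) : x + y ∈ nonunitsIn A := by
  have h := IsLocalRing.nonunits_add ((coe_mem_nonunitsIn ⟨x, hx.1⟩).1 hx)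
    ((coe_mem_nonunitsIn ⟨y, hy.1⟩).1 hy)
  exact (coe_mem_nonunitsIn _).2 h

theorem sub_mem_nonunitsIn [IsLocalRing A] {x y : K} (hx : x ∈ nonunitsIn A)
    (hy : y ∈ nonunitsIn A) : x - y ∈ nonunitsIn A := by
  have := add_mem_nonunitsIn hx (mul_mem_nonunitsIn (A.neg_mem A.one_mem) hy)
  rwa [neg_one_mul, ← sub_eq_add_neg] at this

theorem mem_step_iff [h : IsLocalRing A] {x : K} :
    x ∈ step A ↔ ∀ y ∈ nonunitsIn A, x * y ∈ nonunitsIn A := by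
  unfold step
  rw [dif_pos h]
  constructor
  · intro hx y hy
    obtain ⟨z, hz, e⟩ := hx ⟨y, hy.1⟩ ((coe_mem_nonunitsIn_iff _).1 hy)
    have e' : x * y = z := e
    rw [e']
    exact (coe_mem_nonunitsIn_iff _).2 hz
  · intro hx y hy
    have := hx y ((coe_mem_nonunitsIn_iff _).2 hy)
    exact ⟨⟨x * y, this.1⟩, (coe_mem_nonunitsIn_iff _).1 this, rfl⟩

/-- The maximal ideal of `A` is a proper ideal of its endomorphism ring. -/
theorem nonunitsIn_subset_step [IsLocalRing A] : nonunitsIn A ⊆ nonunitsIn (step A) := fun x hx =>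
  ⟨le_step A hx.1, fun y hy h => one_notMem_nonunitsIn (A := A) (by
    rw [← h, mul_comm]; exact mem_step_iff.1 hy x hx)⟩

/-- The maximal ideal of `step A`, when it is local, lies over that of `A`. -/
theorem mem_nonunitsIn_of_mem_step {x : K} (hx : x ∈ A)
    (h : x ∈ nonunitsIn (step A)) : x ∈ nonunitsIn A :=
  ⟨hx, fun y hy => h.2 y (le_step A hy)⟩

end LocalSubalgebra

/-! ### Stable submodules of a field -/

section Stable

variable {R : Type*} [CommRing R] {K : Type*} [Field K] [Algebra R K]

/-- Stability of a subset `J` of a field `K`, meant for `J` a submodule over a subring of `K`: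
`1` is a sum of products `a * b` with `a ∈ J` and `b ∈ (E : J)`, where `E = (J : J)`; the
condition `b ∈ (E : J)` is written as `b J J ⊆ J`. So `J` is invertible over `E`. -/
def IsStableSet (J : Set K) : Prop :=
  (1 : K) ∈ AddSubmonoid.closure
    {z : K | ∃ a ∈ J, ∃ b : K, (∀ u ∈ J, ∀ v ∈ J, b * u * v ∈ J) ∧ z = a * b}

/-- A nonzero ideal of a domain that is projective over its endomorphism ring is invertible over
it: the coordinate functionals of a dual basis are multiplications by elements of `K`. -/
theorem IsStableIdeal.isStableSet [IsDomain R] [IsFractionRing R K] {I : Ideal R}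
    (hI : IsStableIdeal I) (h0 : I ≠ ⊥) : IsStableSet (algebraMap R K '' I) := by
  obtain ⟨s, hs⟩ := hI.out
  obtain ⟨x₀, hx₀, hne⟩ := Submodule.exists_mem_ne_zero_of_ne_bot h0
  have hinj := IsFractionRing.injective R K
  have hneK : algebraMap R K x₀ ≠ 0 := by simpa using (map_ne_zero_iff _ hinj).2 hne
  let X : I := ⟨x₀, hx₀⟩
  -- the coordinates of `s` are linear over `End I`, hence over `R`
  have s_smul : ∀ (r : R) (x i : I), s (r • x) i = r • s x i := by
    intro r x i
    have : r • x = (r • (1 : Module.End R I)) • x := rfl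
    rw [this, map_smul]
    simp
  have comm : ∀ (f : Module.End R I) (x y : I), (x : R) * (f y : R) = y * (f x : R) := by
    intro f x y
    have h : (x : R) • y = (y : R) • x := Subtype.ext (mul_comm _ _)
    have h2 : (x : R) • f y = (y : R) • f x := by rw [← map_smul, h, map_smul]
    exact congrArg Subtype.val h2
  -- the `i`-th coordinate of `s u` is multiplication by `c i * u` on `I`
  let c : I → K := fun i => algebraMap R K (s X i X) / (algebraMap R K x₀ * algebraMap R K x₀)
  have key : ∀ i u v : I, c i * algebraMap R K u * algebraMap R K v
      = algebraMap R K (s u i v) := by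
    intro i u v
    have h1 : x₀ * (s u i v : R) = u * (s X i v : R) := by
      have : (X : R) • u = (u : R) • X := Subtype.ext (mul_comm _ _)
      have h2 := s_smul X u i
      rw [this, s_smul] at h2
      exact (congrArg Subtype.val (LinearMap.congr_fun h2 v)).symm
    have h3 := comm (s X i) X v
    have h4 : x₀ * x₀ * (s u i v : R) = (s X i X : R) * u * v := by
      have h3' : x₀ * (s X i v : R) = v * (s X i X : R) := h3
      linear_combination x₀ * h1 + (u : R) * h3'
    have h5 := congrArg (algebraMap R K) h4
    simp only [map_mul] at h5
    simp only [c]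
    field_simp
    linear_combination -h5
  have hsum := hs X
  rw [Finsupp.linearCombination_apply, Finsupp.sum] at hsum
  have hsum' : ∑ i ∈ (s X).support, (algebraMap R K i) * c i = 1 := by
    have h := congrArg (fun z : I => algebraMap R K z) hsum
    simp only [AddSubmonoidClass.coe_finsetSum, map_sum] at h
    have h6 : algebraMap R K x₀ * ∑ i ∈ (s X).support, (algebraMap R K i) * c i
        = algebraMap R K x₀ := by
      rw [Finset.mul_sum]
      refine Eq.trans (Finset.sum_congr rfl fun i _ => ?_) h
      have := key i X i
      simp only [id, Module.End.smul_def]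
      rw [← this]
      ring
    exact mul_left_cancel₀ hneK (h6.trans (mul_one _).symm)
  unfold IsStableSet
  rw [← hsum']
  refine sum_mem fun i _ => AddSubmonoid.subset_closure ⟨_, ⟨i, i.2, rfl⟩, c i, ?_, rfl⟩
  rintro _ ⟨u, hu, rfl⟩ _ ⟨v, hv, rfl⟩
  exact ⟨_, (s ⟨u, hu⟩ i ⟨v, hv⟩).2, (key i ⟨u, hu⟩ ⟨v, hv⟩).symm⟩

theorem IsStableSet.of_smul {J : Set K} {d : K} (hd : d ≠ 0)
    (h : IsStableSet {u : K | u / d ∈ J}) : IsStableSet J := by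
  refine AddSubmonoid.closure_mono ?_ h
  rintro _ ⟨a, ha, b, hb, rfl⟩
  refine ⟨a / d, ha, b * d, fun u hu v hv => ?_, by field_simp⟩
  have := hb (d * u) (by simpa [hd] using hu) (d * v) (by simpa [hd] using hv)
  simp only [Set.mem_ofPred_eq] at this
  convert this using 1
  field_simp

/-- Over a finitely stable domain, every fractional ideal with three generators, one of them `1`,
is stable. -/
theorem IsFinitelyStable.isStableSet_span [IsDomain R] [IsFractionRing R K]
    (hfs : IsFinitelyStable R) (x y : K) :
    IsStableSet (Submodule.span R ({1, x, y} : Set K) : Set K) := by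
  obtain ⟨p, q, hq, rfl⟩ := IsFractionRing.div_surjective (A := R) x
  obtain ⟨p', q', hq', rfl⟩ := IsFractionRing.div_surjective (A := R) y
  have hq0 : q ≠ 0 := nonZeroDivisors.ne_zero hq
  have hq0' : q' ≠ 0 := nonZeroDivisors.ne_zero hq'
  have hinj := IsFractionRing.injective R K
  have hqK : algebraMap R K q ≠ 0 := (map_ne_zero_iff _ hinj).2 hq0
  have hqK' : algebraMap R K q' ≠ 0 := (map_ne_zero_iff _ hinj).2 hq0'
  let I : Ideal R := Ideal.span {q * q', p * q', p' * q}
  have hI0 : I ≠ ⊥ := by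
    intro h
    have : q * q' ∈ I := Ideal.subset_span (by simp)
    rw [h] at this
    exact mul_ne_zero hq0 hq0' this
  have hst := (hfs I hI0 (Submodule.fg_span (Set.toFinite _))).isStableSet (K := K) hI0
  refine IsStableSet.of_smul (mul_ne_zero hqK hqK') ?_
  convert hst using 1
  ext u
  simp only [Set.mem_ofPred_eq, SetLike.mem_coe, Submodule.mem_span_triple, Set.mem_image, I,
    Ideal.span, Algebra.smul_def, Algebra.algebraMap_self_apply]
  constructor
  · rintro ⟨a, b, c, h⟩
    refine ⟨_, ⟨a, b, c, rfl⟩, ?_⟩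
    simp only [map_add, map_mul]
    field_simp at h
    linear_combination h
  · rintro ⟨_, ⟨a, b, c, rfl⟩, rfl⟩
    refine ⟨a, b, c, ?_⟩
    simp only [map_add, map_mul]
    field_simp

/-- Extending scalars to an intermediate ring preserves stability. -/
theorem IsStableSet.span_subalgebra (A : Subalgebra R K) {S : Set K}
    (h : IsStableSet (Submodule.span R S : Set K)) :
    IsStableSet (Submodule.span A S : Set K) := by
  refine AddSubmonoid.closure_mono ?_ h
  have hle : ∀ z ∈ Submodule.span R S, z ∈ Submodule.span A S := fun z hz =>
    Submodule.span_subset_span R A S hz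
  rintro _ ⟨a, ha, b, hb, rfl⟩
  refine ⟨a, hle a ha, b, fun u hu v hv => ?_, rfl⟩
  induction hu, hv using Submodule.span_induction₂ with
  | mem_mem u v hu hv => exact hle _ (hb u (Submodule.subset_span hu) v (Submodule.subset_span hv))
  | zero_left v hv => simp
  | zero_right v hv => simp
  | add_left u₁ u₂ v _ _ _ h₁ h₂ => rw [mul_add, add_mul]; exact add_mem h₁ h₂
  | add_right u v₁ v₂ _ _ _ h₁ h₂ => rw [mul_add]; exact add_mem h₁ h₂
  | smul_left r u v _ _ h =>
    have : b * r • u * v = r • (b * u * v) := by simp only [Algebra.smul_def]; ring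
    rw [SetLike.mem_coe, this]; exact Submodule.smul_mem _ r h
  | smul_right r u v _ _ h =>
    have : b * u * r • v = r • (b * u * v) := by simp only [Algebra.smul_def]; ring
    rw [SetLike.mem_coe, this]; exact Submodule.smul_mem _ r h

/-- If a stable `J` has its endomorphism ring inside a local ring `B`, then one of the products
occurring in a representation of `1` is already a unit of `B`. -/
theorem IsStableSet.exists_notMem_nonunitsIn {J : Set K} (h : IsStableSet J) (B : Subalgebra R K)
    [IsLocalRing B] : ∃ a ∈ J, ∃ b : K, (∀ u ∈ J, ∀ v ∈ J, b * u * v ∈ J) ∧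
      a * b ∉ nonunitsIn B := by
  by_contra! hcon
  refine one_notMem_nonunitsIn (A := B) ?_
  refine AddSubmonoid.closure_induction (motive := fun z _ => z ∈ nonunitsIn B) ?_
    zero_mem_nonunitsIn (fun _ _ _ _ => add_mem_nonunitsIn) h
  rintro _ ⟨a, ha, b, hb, rfl⟩
  exact hcon a ha b hb

end Stable

/-! ### Modules between a local ring and the endomorphism ring of its maximal ideal -/

section Between

variable {R : Type*} [CommRing R] {K : Type*} [Field K] [Algebra R K] {A : Subalgebra R K}

/-- A relation `q(e) ∈ M` over a local ring `(A, M)` with a unit coefficient lets one invert `e`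
inside `A[e]`, provided multiplication by `e⁻¹` preserves `M`: constant terms lying in `M` are
discarded until a unit is reached. -/
theorem exists_aeval_mul_eq_one [IsLocalRing A] {e : K} (he : e ≠ 0) (hinv : e⁻¹ ∈ step A) (n : ℕ)
    (q : Polynomial A) (hq : IsUnit (q.coeff n)) (hM : Polynomial.aeval e q ∈ nonunitsIn A) :
    ∃ q' : Polynomial A, Polynomial.aeval e q' * e = 1 := by
  have hdivX : ∀ q : Polynomial A,
      Polynomial.aeval e q.divX * e + (q.coeff 0 : K) = Polynomial.aeval e q := by
    intro q
    conv_rhs => rw [← q.divX_mul_X_add]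
    simp
  by_cases hq₀ : IsUnit (q.coeff 0)
  · have h2 : (q.coeff 0 : K) - Polynomial.aeval e q ∉ nonunitsIn A := by
      intro h
      have h3 := add_mem_nonunitsIn h hM
      rw [sub_add_cancel, coe_mem_nonunitsIn] at h3
      exact h3 hq₀
    obtain ⟨h0, hi⟩ := ne_zero_and_inv_mem (A.sub_mem (q.coeff 0).2 hM.1) h2
    refine ⟨Polynomial.C (-⟨_, hi⟩) * q.divX, ?_⟩
    have h4 : Polynomial.aeval e q.divX * e = -((q.coeff 0 : K) - Polynomial.aeval e q) := by
      linear_combination hdivX q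
    rw [map_mul, mul_assoc, h4]
    simp only [Polynomial.aeval_C, map_neg, neg_mul_neg]
    exact inv_mul_cancel₀ h0
  · cases n with
    | zero => exact absurd hq hq₀
    | succ n =>
      refine exists_aeval_mul_eq_one he hinv n q.divX (by simpa using hq) ?_
      have h2 : Polynomial.aeval e q.divX * e ∈ nonunitsIn A := by
        rw [eq_sub_of_add_eq (hdivX q)]
        exact sub_mem_nonunitsIn hM ((coe_mem_nonunitsIn _).2 hq₀)
      have h3 := mem_step_iff.1 hinv _ h2
      convert h3 using 1
      field_simp

theorem aeval_mul_mem {I : Submodule A K} {e : K} (he : ∀ u ∈ I, e * u ∈ I) (q : Polynomial A)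
    {u : K} (hu : u ∈ I) : Polynomial.aeval e q * u ∈ I := by
  induction q using Polynomial.induction_on generalizing u with
  | C a => simpa [Algebra.smul_def] using I.smul_mem a hu
  | add p q hp hq => rw [map_add, add_mul]; exact I.add_mem (hp hu) (hq hu)
  | monomial n a h =>
    have := h (he u hu)
    convert this using 1
    simp only [map_mul, map_pow, Polynomial.aeval_X, pow_succ]
    ring

/-- An endomorphism `e` of a finitely generated `A`-module that is a unit of `E(M_A)` is an
automorphism of the module. -/
theorem inv_mul_mem [IsLocalRing A] {I : Submodule A K} (hfg : I.FG) (hI : I ≠ ⊥) {e : K}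
    (he0 : e ≠ 0) (he : ∀ u ∈ I, e * u ∈ I) (hinv : e⁻¹ ∈ step A) {u : K} (hu : u ∈ I) :
    e⁻¹ * u ∈ I := by
  obtain ⟨q, hq, hq0⟩ := isIntegral_of_smul_mem_submodule I hI hfg e he
  rw [← Polynomial.aeval_def] at hq0
  obtain ⟨q', hq'⟩ := exists_aeval_mul_eq_one he0 hinv q.natDegree q
    (by rw [hq.coeff_natDegree]; exact isUnit_one) (by rw [hq0]; exact zero_mem_nonunitsIn)
  rw [← eq_inv_of_mul_eq_one_left hq']
  exact aeval_mul_mem he q' hu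

/-- If `A` and `E(M_A)` are local, then stable finitely generated `A`-modules between them are
rings: such a module `I` is of the form `a E(I)`, and `a` is a unit of `E(I)` since `1 ∈ I`. -/
theorem mul_mem_of_isStableSet [IsLocalRing A] [IsLocalRing (step A)] {I : Submodule A K}
    (hst : IsStableSet (I : Set K)) (hfg : I.FG) (h1 : (1 : K) ∈ I) (hle : ∀ u ∈ I, u ∈ step A)
    {u v : K} (hu : u ∈ I) (hv : v ∈ I) : u * v ∈ I := by
  have hI : I ≠ ⊥ := by
    rintro rfl
    exact one_ne_zero ((Submodule.mem_bot A).1 h1)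
  have hE : ∀ e : K, (∀ u ∈ I, e * u ∈ I) → e ∈ I := fun e he => by simpa using he 1 h1
  obtain ⟨a, ha, b, hb, hab⟩ := hst.exists_notMem_nonunitsIn (step A)
  have habI : ∀ u ∈ I, a * b * u ∈ I := fun u hu => by
    have := hb a ha u hu
    rwa [mul_comm b a] at this
  obtain ⟨hab0, habinv⟩ := ne_zero_and_inv_mem (hle _ (hE _ habI)) hab
  have ha0 : a ≠ 0 := left_ne_zero_of_mul hab0
  have hb0 : b ≠ 0 := right_ne_zero_of_mul hab0
  -- every `v ∈ I` is `a` times an element of the endomorphism ring, namely `v / a`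
  have hdiv : ∀ v ∈ I, ∀ u ∈ I, v / a * u ∈ I := by
    intro v hv u hu
    have := inv_mul_mem hfg hI hab0 habI habinv (hb v hv u hu)
    convert this using 1
    field_simp
  have hinvI : ∀ u ∈ I, a⁻¹ * u ∈ I := fun u hu => by simpa using hdiv 1 h1 u hu
  have haI : ∀ u ∈ I, a * u ∈ I := fun u hu => by
    simpa using inv_mul_mem hfg hI (inv_ne_zero ha0) hinvI (by simpa using hle a ha) hu
  have := haI _ (hdiv u hu v hv)
  convert this using 1
  field_simp

/-- Let `A` and `E(M_A)` be local. If the `A`-modules with three generators, one of them `1`, are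
stable, then the product of two nonunits of `E(M_A)` lies in `M_A`. -/
theorem mul_mem_nonunitsIn_of_mem_step [IsLocalRing A] [IsLocalRing (step A)]
    (hst : ∀ x y : K, IsStableSet (Submodule.span A ({1, x, y} : Set K) : Set K)) {x y : K}
    (hx : x ∈ nonunitsIn (step A)) (hy : y ∈ nonunitsIn (step A)) : x * y ∈ nonunitsIn A := by
  have hmul : ∀ x ∈ nonunitsIn (step A), ∀ y ∈ nonunitsIn (step A),
      ∃ b c : A, ∃ g ∈ nonunitsIn A, x * y = g + b * x + c * y := by
    intro x hx y hy
    have h := mul_mem_of_isStableSet (hst x y) (Submodule.fg_span (Set.toFinite _))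
      (Submodule.subset_span (by simp)) ?_ (Submodule.subset_span (by simp : x ∈ _))
      (Submodule.subset_span (by simp : y ∈ _))
    · obtain ⟨a, b, c, h⟩ := Submodule.mem_span_triple.1 h
      simp only [Algebra.smul_def, Subalgebra.algebraMap_def, mul_one] at h
      have ha : (a : K) = x * y - b * x - c * y := by linear_combination h
      have hA := fun r : A => le_step A r.2
      refine ⟨b, c, a, mem_nonunitsIn_of_mem_step a.2 ?_, h.symm⟩
      rw [ha]
      exact sub_mem_nonunitsIn (sub_mem_nonunitsIn (mul_mem_nonunitsIn hx.1 hy)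
        (mul_mem_nonunitsIn (hA b) hx)) (mul_mem_nonunitsIn (hA c) hy)
    · intro u hu
      obtain ⟨a, b, c, rfl⟩ := Submodule.mem_span_triple.1 hu
      simp only [Algebra.smul_def, Subalgebra.algebraMap_def, mul_one]
      exact add_mem (add_mem (le_step A a.2) (mul_mem (le_step A b.2) hx.1))
        (mul_mem (le_step A c.2) hy.1)
  -- a coefficient from `A` is either a unit of `A` or multiplies `E(M_A)` into `M_A`
  have hcases : ∀ (a : A) (z : K), z ∈ step A → ((a : K) ≠ 0 ∧ (a : K)⁻¹ ∈ A) ∨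
      (a : K) * z ∈ nonunitsIn A := by
    intro a z hz
    by_cases ha : (a : K) ∈ nonunitsIn A
    · right; rw [mul_comm]; exact mem_step_iff.1 hz _ ha
    · exact Or.inl (ne_zero_and_inv_mem a.2 ha)
  have hcancel : ∀ a z : K, a ≠ 0 → a⁻¹ ∈ A → a * z ∈ nonunitsIn A → z ∈ nonunitsIn A := by
    intro a z h0 ha h
    simpa [h0] using mul_mem_nonunitsIn ha h
  have hsq : ∀ x ∈ nonunitsIn (step A), x * x ∈ nonunitsIn A := by
    intro x hx
    obtain ⟨b, c, g, hg, h⟩ := hmul x hx x hx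
    obtain ⟨h0, hinv⟩ | hbc := hcases (b + c) x hx.1
    · -- `x * (x - (b + c))` is in `M_A` and the second factor is a unit of `E(M_A)`
      have hu : x - (b + c : A) ∉ nonunitsIn (step A) := by
        intro hu
        have h1 := mem_nonunitsIn_of_mem_step (b + c).2 (by simpa using sub_mem_nonunitsIn hx hu)
        exact h1.2 _ hinv (mul_inv_cancel₀ h0)
      obtain ⟨hu0, hui⟩ := ne_zero_and_inv_mem
        (sub_mem hx.1 (le_step A (b + c).2)) hu
      have h2 := mem_step_iff.1 (mul_mem hx.1 hui) g hg
      convert h2 using 1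
      push_cast at hu0 ⊢
      field_simp
      linear_combination x * h
    · rw [h, add_assoc, ← add_mul]
      exact add_mem_nonunitsIn hg hbc
  obtain ⟨b, c, g, hg, h⟩ := hmul x hx y hy
  obtain ⟨hb0, hbinv⟩ | hb := hcases b x hx.1
  · refine hcancel b _ hb0 hbinv ?_
    have : b * (x * y) = x * (y * y) - y * g - c * (y * y) := by linear_combination -y * h
    rw [this]
    exact sub_mem_nonunitsIn (sub_mem_nonunitsIn (mem_step_iff.1 hx.1 _ (hsq y hy))
      (mem_step_iff.1 hy.1 _ hg)) (mul_mem_nonunitsIn c.2 (hsq y hy))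
  obtain ⟨hc0, hcinv⟩ | hc := hcases c y hy.1
  · refine hcancel c _ hc0 hcinv ?_
    have : c * (x * y) = y * (x * x) - x * g - b * (x * x) := by linear_combination -x * h
    rw [this]
    exact sub_mem_nonunitsIn (sub_mem_nonunitsIn (mem_step_iff.1 hy.1 _ (hsq x hx))
      (mem_step_iff.1 hx.1 _ hg)) (mul_mem_nonunitsIn b.2 (hsq x hx))
  rw [h]
  exact add_mem_nonunitsIn (add_mem_nonunitsIn hg hb) hc

end Between

/-! ### Principality of the maximal ideals -/

section Divisibility

variable {R : Type*} [CommRing R] {K : Type*} [Field K] [Algebra R K]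

/-- How the maximal ideal `M` of a local ring `A` of the chain sits relative to the fixed element
`m ∈ M`: either `M` is contained in `m E(M)`, or it is principal, say `M = t A`, and `m` is an
associate of `t ^ 2` (the second alternative only records `m ∈ t A` and `t ^ 2 ∈ m A`). -/
def IsControlledBy (A : Subalgebra R K) (m : K) : Prop :=
  (∀ x ∈ nonunitsIn A, ∃ y ∈ step A, x = m * y) ∨
    ∃ t ∈ nonunitsIn A, (∃ w ∈ A, m = t * w) ∧ (∃ w ∈ A, t * t = m * w) ∧
      ∀ x ∈ nonunitsIn A, ∃ y ∈ A, x = t * y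

variable {A : Subalgebra R K}

/-- A stable maximal ideal `M` with local endomorphism ring is principal over that ring. -/
theorem IsStableSet.exists_forall_eq_mul [IsLocalRing A] [IsLocalRing (step A)]
    (hst : IsStableSet (nonunitsIn A)) :
    ∃ m ∈ nonunitsIn A, m ≠ 0 ∧ ∀ x ∈ nonunitsIn A, ∃ y ∈ step A, x = m * y := by
  obtain ⟨a, ha, b, hb, hab⟩ := hst.exists_notMem_nonunitsIn (step A)
  have hmem : ∀ x ∈ nonunitsIn A, x * b ∈ step A := fun x hx =>
    mem_step_iff.2 fun y hy => by rw [mul_comm x b]; exact hb x hx y hy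
  obtain ⟨h0, hinv⟩ := ne_zero_and_inv_mem (hmem a ha) hab
  have ha0 : a ≠ 0 := left_ne_zero_of_mul h0
  have hb0 : b ≠ 0 := right_ne_zero_of_mul h0
  exact ⟨a, ha, ha0, fun x hx => ⟨_, mul_mem (hmem x hx) hinv, by field_simp⟩⟩

/-- If the second alternative holds for `A`, then `E(M_A) = A` because `M_A` is principal, and
there is nothing to show. Otherwise let `N` be the maximal ideal of `B = E(M_A)`, so that `N N ⊆ M_A ⊆ m B`. Either `N N ⊆ m N`, and
then `m⁻¹ N ⊆ E(N)`; or `m` is, up to a unit, a product `x y` of elements of `N`, and then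
`N = x B = y B`. -/
theorem IsControlledBy.step [IsLocalRing A] [IsLocalRing (step A)] {m : K} (hm0 : m ≠ 0)
    (h : IsControlledBy A m)
    (hmul : ∀ x ∈ nonunitsIn (OlberdingChain.step A), ∀ y ∈ nonunitsIn (OlberdingChain.step A),
      x * y ∈ nonunitsIn A) :
    IsControlledBy (OlberdingChain.step A) m := by
  obtain h | ⟨t, ht, ⟨w, hw, hmt⟩, ht2, hdiv⟩ := id h
  · by_cases hc : ∀ x ∈ nonunitsIn (OlberdingChain.step A),
        ∀ y ∈ nonunitsIn (OlberdingChain.step A),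
        ∃ z ∈ nonunitsIn (OlberdingChain.step A), x * y = m * z
    · left
      intro x hx
      refine ⟨x / m, mem_step_iff.2 fun y hy => ?_, by field_simp⟩
      obtain ⟨z, hz, hxy⟩ := hc x hx y hy
      convert hz using 1
      field_simp
      exact hxy
    · push Not at hc
      obtain ⟨x, hx, y, hy, hxy⟩ := hc
      obtain ⟨u, hu, hxyu⟩ := h _ (hmul x hx y hy)
      obtain ⟨hu0, hui⟩ := ne_zero_and_inv_mem hu fun hu' => hxy u hu' hxyu
      have hxy0 : x * y ≠ 0 := by rw [hxyu]; exact mul_ne_zero hm0 hu0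
      have hx0 : x ≠ 0 := left_ne_zero_of_mul hxy0
      have hy0 : y ≠ 0 := right_ne_zero_of_mul hxy0
      have hmxy : m = x * y * u⁻¹ := by rw [hxyu]; field_simp
      have hydvd : ∀ z ∈ nonunitsIn (OlberdingChain.step A),
          ∃ s ∈ OlberdingChain.step A, z = y * s := by
        intro z hz
        obtain ⟨r, hr, hxz⟩ := h _ (hmul x hx z hz)
        refine ⟨u⁻¹ * r, mul_mem hui hr, mul_left_cancel₀ hx0 ?_⟩
        rw [hxz, hmxy]
        ring
      obtain ⟨r, hr, hyy⟩ := h _ (hmul y hy y hy)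
      exact Or.inr ⟨y, hy, ⟨x * u⁻¹, mul_mem hx.1 hui, by rw [hmxy]; ring⟩, ⟨r, hr, hyy⟩, hydvd⟩
  · have ht0 : t ≠ 0 := by rintro rfl; exact hm0 (by rw [hmt, zero_mul])
    have hA : OlberdingChain.step A = A := by
      refine le_antisymm (fun e he => ?_) (le_step A)
      obtain ⟨y, hy, hey⟩ := hdiv _ (mem_step_iff.1 he t ht)
      have : e = y := mul_right_cancel₀ ht0 (hey.trans (mul_comm _ _))
      rwa [this]
    rw [hA]
    exact h

end Divisibility

/-! ### The chain of local rings -/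

section LocalChain

variable {R : Type*} [CommRing R] {K : Type*} [Field K] [Algebra R K]

theorem isLocalRing_chainUnion (h : ∀ n, IsLocalRing (chain R K n)) :
    IsLocalRing (chainUnion R K) := by
  refine .of_isUnit_or_isUnit_one_sub_self fun a => ?_
  obtain ⟨n, hn⟩ := mem_chainUnion.1 a.2
  let i : chain R K n →ₐ[R] chainUnion R K := Subalgebra.inclusion (le_iSup (chain R K) n)
  have hi : i ⟨a, hn⟩ = a := rfl
  have := h n
  refine (IsLocalRing.isUnit_or_isUnit_one_sub_self (⟨a, hn⟩ : chain R K n)).imp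
    (fun hu => ?_) (fun hu => ?_)
  · rw [← hi]; exact hu.map i
  · have := hu.map i
    rwa [map_sub, map_one, hi] at this

/-- The chain is stationary from the first ring that is not local. -/
theorem chainUnion_eq_of_not_isLocalRing {n : ℕ} (h : ¬ IsLocalRing (chain R K n)) :
    chainUnion R K = chain R K n := by
  have hstep : ∀ k, chain R K (n + k) = chain R K n := by
    intro k
    induction k with
    | zero => rfl
    | succ k ih =>
      change step (chain R K (n + k)) = _
      rw [ih, step, dif_neg h]
  refine le_antisymm (iSup_le fun k => ?_) (le_iSup (chain R K) n)
  exact (chain_mono (Nat.le_add_left k n)).trans (hstep k).le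

theorem forall_isLocalRing_chain (h : IsLocalRing (chainUnion R K)) (n : ℕ) :
    IsLocalRing (chain R K n) := by
  by_contra hn
  rw [chainUnion_eq_of_not_isLocalRing hn] at h
  exact hn h

theorem mem_nonunitsIn_bot_iff [IsLocalRing R] (hinj : Function.Injective (algebraMap R K))
    {x : K} : x ∈ nonunitsIn (⊥ : Subalgebra R K) ↔
      ∃ r ∈ IsLocalRing.maximalIdeal R, algebraMap R K r = x := by
  constructor
  · rintro ⟨hx, hn⟩
    obtain ⟨r, rfl⟩ := Algebra.mem_bot.1 hx
    refine ⟨r, ?_, rfl⟩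
    rw [IsLocalRing.mem_maximalIdeal, mem_nonunits_iff, isUnit_iff_exists_inv]
    rintro ⟨s, hs⟩
    exact hn _ (Algebra.mem_bot.2 ⟨s, rfl⟩) (by rw [← map_mul, hs, map_one])
  · rintro ⟨r, hr, rfl⟩
    refine ⟨Algebra.mem_bot.2 ⟨r, rfl⟩, fun y hy h => ?_⟩
    obtain ⟨s, rfl⟩ := Algebra.mem_bot.1 hy
    rw [← map_mul, ← map_one (algebraMap R K)] at h
    exact hr (IsUnit.of_mul_eq_one s (hinj h))

/-- When all rings of the chain are local, a single `m ∈ M` controls all their maximal ideals. -/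
theorem exists_forall_isControlledBy [IsDomain R] [IsLocalRing R] [IsFractionRing R K]
    (hfield : ¬ IsField R) (hfs : IsFinitelyStable R)
    (hstable : IsStableIdeal (IsLocalRing.maximalIdeal R))
    (hloc : ∀ n, IsLocalRing (chain R K n)) :
    ∃ m : K, m ≠ 0 ∧ ∀ n, m ∈ nonunitsIn (chain R K n) ∧ IsControlledBy (chain R K n) m := by
  have hM : IsStableSet (nonunitsIn (chain R K 0)) := by
    convert hstable.isStableSet (K := K) (IsLocalRing.isField_iff_maximalIdeal_eq.not.1 hfield)
    ext x
    exact mem_nonunitsIn_bot_iff (IsFractionRing.injective R K)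
  have := hloc 0
  have : IsLocalRing (step (chain R K 0)) := hloc 1
  obtain ⟨m, hm, hm0, hdiv⟩ := hM.exists_forall_eq_mul
  refine ⟨m, hm0, fun n => ?_⟩
  induction n with
  | zero => exact ⟨hm, Or.inl hdiv⟩
  | succ n ih =>
    have := hloc n
    have : IsLocalRing (step (chain R K n)) := hloc (n + 1)
    exact ⟨nonunitsIn_subset_step ih.1, ih.2.step hm0 fun x hx y hy =>
      mul_mem_nonunitsIn_of_mem_step
        (fun x y => (hfs.isStableSet_span x y).span_subalgebra _) hx hy⟩

/-- `m ^ n` conducts the `n`-th ring of the chain into `R`. -/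
theorem exists_algebraMap_eq_pow_mul {m : K} (hloc : ∀ n, IsLocalRing (chain R K n))
    (hm : ∀ n, m ∈ nonunitsIn (chain R K n)) (n : ℕ) {z : K} (hz : z ∈ chain R K n) :
    ∃ r : R, algebraMap R K r = m ^ n * z := by
  induction n generalizing z with
  | zero => simpa using Algebra.mem_bot.1 hz
  | succ n ih =>
    have := hloc n
    have h : z * m ∈ nonunitsIn (chain R K n) := mem_step_iff.1 hz m (hm n)
    obtain ⟨r, hr⟩ := ih h.1
    exact ⟨r, by rw [hr]; ring⟩

/-- An element of a prime `P` of `R` avoiding `m` is divisible by every power of `m` in the union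
of the chain. The induction runs over the `z` with `m ^ k * z ∈ P` for some `k`; these are nonunits
of the rings of the chain, and the set of them is closed under division by `m`. -/
theorem exists_eq_pow_mul_of_mem_prime {m₀ : R} (hinj : Function.Injective (algebraMap R K))
    (hloc : ∀ n, IsLocalRing (chain R K n))
    (hm : ∀ n, algebraMap R K m₀ ∈ nonunitsIn (chain R K n))
    (hctrl : ∀ n, IsControlledBy (chain R K n) (algebraMap R K m₀))
    {P : Ideal R} [P.IsPrime] (hmP : m₀ ∉ P) {p : R} (hp : p ∈ P) (n : ℕ) :
    ∃ z ∈ chain R K n, algebraMap R K p = algebraMap R K m₀ ^ n * z := by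
  set m := algebraMap R K m₀ with hm_def
  have hnonunit : ∀ n, ∀ z ∈ chain R K n, ∀ k, ∀ p ∈ P, algebraMap R K p = m ^ k * z →
      z ∈ nonunitsIn (chain R K n) := by
    intro n z hz k p hp hpz
    by_contra hzu
    obtain ⟨hz0, hzi⟩ := ne_zero_and_inv_mem hz hzu
    obtain ⟨r, hr⟩ := exists_algebraMap_eq_pow_mul hloc hm n hzi
    have h : m₀ ^ (k + n) = p * r := hinj (by
      rw [map_mul, map_pow, hpz, hr, ← hm_def]
      field_simp
      ring)
    exact hmP (Ideal.IsPrime.mem_of_pow_mem ‹_› (k + n) (h ▸ P.mul_mem_right r hp))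
  induction n with
  | zero => exact ⟨_, Algebra.mem_bot.2 ⟨p, rfl⟩, by simp⟩
  | succ n ih =>
    obtain ⟨z, hz, hpz⟩ := ih
    have hzn := hnonunit n z hz n p hp hpz
    suffices h : ∃ y ∈ chain R K (n + 1), z = m * y by
      obtain ⟨y, hy, rfl⟩ := h
      exact ⟨y, hy, by rw [hpz]; ring⟩
    obtain h | ⟨t, ht, ⟨w, hw, hmt⟩, ⟨s, hs, hts⟩, hdiv⟩ := hctrl n
    · exact h z hzn
    · obtain ⟨y, hy, rfl⟩ := hdiv z hzn
      obtain ⟨r, hr⟩ := exists_algebraMap_eq_pow_mul hloc hm n hw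
      have hyn := hnonunit n y hy (n + n + 1) (p * r) (P.mul_mem_right r hp) (by
        rw [map_mul, hpz, hr]
        linear_combination (-m ^ (n + n) * y) * hmt)
      obtain ⟨x, hx, rfl⟩ := hdiv y hyn
      exact ⟨s * x, chain_mono n.le_succ (mul_mem hs hx), by linear_combination x * hts⟩

theorem ringKrullDim_eq_one_of_isLocalRing_chain [IsDomain R] [IsLocalRing R]
    [IsFractionRing R K] (hfield : ¬ IsField R) (hfs : IsFinitelyStable R)
    (hstable : IsStableIdeal (IsLocalRing.maximalIdeal R)) (harch : IsArchimedeanDomain R)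
    (hloc : ∀ n, IsLocalRing (chain R K n)) : ringKrullDim R = 1 := by
  have hinj := IsFractionRing.injective R K
  obtain ⟨m, hm0, h⟩ := exists_forall_isControlledBy hfield hfs hstable hloc
  have hm := fun n => (h n).1
  have hctrl := fun n => (h n).2
  obtain ⟨m₀, hm₀, rfl⟩ := (mem_nonunitsIn_bot_iff hinj).1 (hm 0)
  -- `p ^ 2 = m₀ ^ n * (m₀ ^ n * z ^ 2)` with `z` in the `n`-th ring, so the second factor is in `R`
  have hprime : ∀ P : Ideal R, P.IsPrime → m₀ ∉ P → P = ⊥ := by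
    intro P hP hmP
    refine (Submodule.eq_bot_iff _).2 fun p hp => ?_
    have hpp : p * p ∈ ⨅ n : ℕ, Ideal.span {m₀ ^ n} := by
      refine Submodule.mem_iInf _ |>.2 fun n => Ideal.mem_span_singleton'.2 ?_
      obtain ⟨z, hz, hpz⟩ := exists_eq_pow_mul_of_mem_prime hinj hloc hm hctrl hmP hp n
      obtain ⟨r, hr⟩ := exists_algebraMap_eq_pow_mul hloc hm n (mul_mem hz hz)
      refine ⟨r, hinj ?_⟩
      rw [map_mul, map_mul, map_pow, hr, hpz]
      ring
    rw [harch m₀ hm₀] at hpp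
    exact mul_self_eq_zero.1 hpp
  refine ringKrullDim_eq_one_iff_of_isLocalRing_isDomain.2 ⟨hfield, fun x hx => ?_⟩
  have hmx : m₀ ∈ (Ideal.span {x}).radical := by
    rw [Ideal.radical_eq_sInf]
    refine Submodule.mem_sInf.2 fun P ⟨hxP, hP⟩ => ?_
    by_contra hmP
    rw [hprime P hP hmP, Ideal.span_singleton_le_iff_mem] at hxP
    exact hx hxP
  intro y hy
  have := hloc 0
  have hy' : algebraMap R K y ∈ nonunitsIn (chain R K 0) :=
    (mem_nonunitsIn_bot_iff hinj).2 ⟨y, hy, rfl⟩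
  have hsq : ∃ s ∈ chain R K 0, algebraMap R K (y * y) = algebraMap R K m₀ * s := by
    rw [map_mul]
    obtain hdiv | ⟨t, ht, -, ⟨w, hw, htw⟩, hdiv⟩ := hctrl 0
    · obtain ⟨z, hz, hyz⟩ := hdiv _ hy'
      exact ⟨_, (mem_step_iff.1 hz _ hy').1, by rw [← mul_assoc, ← hyz]⟩
    · obtain ⟨z, hz, hyz⟩ := hdiv _ hy'
      exact ⟨_, mul_mem hw (mul_mem hz hz), by rw [hyz]; linear_combination z * z * htw⟩
  obtain ⟨_, hs, hys⟩ := hsq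
  obtain ⟨s, rfl⟩ := Algebra.mem_bot.1 hs
  rw [← map_mul] at hys
  refine (Ideal.radical_isRadical _) ⟨2, ?_⟩
  rw [pow_two, hinj hys]
  exact Ideal.mul_mem_right s _ hmx

end LocalChain

end OlberdingChain

theorem mainTheorem11 {R : Type*} [CommRing R] [IsDomain R] [IsLocalRing R]
    (K : Type*) [Field K] [Algebra R K] [IsFractionRing R K]
    (hfield : ¬ IsField R)
    (hfs : OlberdingChain.IsFinitelyStable R)
    (hstable : OlberdingChain.IsStableIdeal (IsLocalRing.maximalIdeal R))
    (harch : OlberdingChain.IsArchimedeanDomain R) :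
    (IsLocalRing (OlberdingChain.chainUnion R K) → ringKrullDim R = 1) ∧
      ((∀ n : ℕ, OlberdingChain.chainUnion R K ≠ OlberdingChain.chain R K n) →
        IsLocalRing (OlberdingChain.chainUnion R K)) := by
  refine ⟨fun hT => OlberdingChain.ringKrullDim_eq_one_of_isLocalRing_chain (K := K) hfield hfs
    hstable harch (OlberdingChain.forall_isLocalRing_chain hT), fun hne => ?_⟩
  refine OlberdingChain.isLocalRing_chainUnion fun n => ?_
  by_contra hn
  exact hne n (OlberdingChain.chainUnion_eq_of_not_isLocalRing hn)
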